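/- Let $k\ge 0$ and let $F$ be a set of unordered pairs $\{i,j\}$ of distinct elements of $[k]=\{1,\ldots,k\}$. Let $G=G_F$ be the graph group with generators $g_1,\ldots,g_k$ and relations $g_ig_j=g_jg_i$ for all $\{i,j\}\notin F$. The elements $g_1,g_1^{-1},\ldots,g_k,g_k^{-1}$ are called symbols; two symbols are independent if they belong to distinct generators $g_i,g_j$ with $\{i,j\}\notin F$. A word in the symbols is reduced if it is not of the form $x\alpha y\alpha^{-1}z$ with words $x,y,z$ and a symbol $\alpha$ independent of all symbols in $y$. For $x\in G$, let $|x|$ be the size of any reduced word representing $x$, and say that $x$ contains a symbol $\alpha$ if $\alpha$ occurs in any reduced word representing $x$ (neither depends on the reduced word chosen). Call $x$ connected if the generators occurring in $x$ (as $g_i$ or as $g_i^{-1}$) induce a connected subgraph of the graph $([k],F)$. For $x,y,z\in G$ write $z=x\cdot y$ if $z=xy$ and $|z|=|x|+|y|$, and write $x\le z$ if $z=x\cdot a$ for some $a\in G$. A symbol $\alpha$ is a maximal symbol of $x$ if $\alpha^{-1}\le x^{-1}$, and $p\in G$ is an $\alpha$-peak if $\alpha$ is a maximal symbol of $p$ and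 $p$ has no other maximal symbol. Proposition. Let $q\in G$ be connected and contain the symbol $\alpha$, and let $p$ be an $\alpha$-peak with $p\le pq$. Then there exist an $\alpha$-peak $r$ and an integer $t\ge 0$ with $p=r\cdot q^t$ (that is, $p=rq^t$ and $|p|=|r|+|q^t|$) and $|r|\le 2\,|pqp^{-1}|^2$. -/

import Mathlib

namespace GraphGroup

/-- Symbols `g_i` (coded `(i, true)`) and `g_i⁻¹` (coded `(i, false)`) on `k` generators. -/
abbrev Symb (k : ℕ) : Type := Fin k × Bool

/-- The inverse of a symbol. -/
def Symb.inv {k : ℕ} (a : Symb k) : Symb k := (a.1, !a.2)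

/-- Words are finite sequences of symbols. -/
abbrev Word (k : ℕ) : Type := List (Symb k)

/-- The relators of the graph group: generators `g_i`, `g_j` commute whenever `{i, j}` is not
an edge of `F` (for `i = j` the relator is trivial). -/
def relators {k : ℕ} (F : SimpleGraph (Fin k)) : Set (FreeGroup (Fin k)) :=
  {r | ∃ i j : Fin k, ¬ F.Adj i j ∧
    r = FreeGroup.of i * FreeGroup.of j * (FreeGroup.of i)⁻¹ * (FreeGroup.of j)⁻¹}

/-- The graph group `G_F`; edges of `F` are the pairs of generators that do *not* commute. -/
abbrev Grp {k : ℕ} (F : SimpleGraph (Fin k)) : Type := PresentedGroup (relators F)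

/-- The group element represented by a word. -/
def ofWord {k : ℕ} (F : SimpleGraph (Fin k)) (w : Word k) : Grp F :=
  PresentedGroup.mk (relators F) (FreeGroup.mk w)

/-- A symbol as a group element. -/
def ofSymb {k : ℕ} (F : SimpleGraph (Fin k)) (a : Symb k) : Grp F := ofWord F [a]

/-- Independence of symbols: distinct generators that are not joined by an edge of `F`. -/
def IndepSymb {k : ℕ} (F : SimpleGraph (Fin k)) (a b : Symb k) : Prop :=
  a.1 ≠ b.1 ∧ ¬ F.Adj a.1 b.1

/-- A word is reduced if it is not of the form `x a y a⁻¹ z` with the symbol `a` independent of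
all symbols of `y`. -/
def IsReducedWord {k : ℕ} (F : SimpleGraph (Fin k)) (w : Word k) : Prop :=
  ¬ ∃ (x y z : Word k) (a : Symb k),
    w = x ++ [a] ++ y ++ [a.inv] ++ z ∧ ∀ b ∈ y, IndepSymb F a b

/-- `w` is a reduced word representing `g`. -/
def IsReducedFor {k : ℕ} (F : SimpleGraph (Fin k)) (w : Word k) (g : Grp F) : Prop :=
  IsReducedWord F w ∧ ofWord F w = g

theorem ofWord_append {k : ℕ} (F : SimpleGraph (Fin k)) (v w : Word k) :
    ofWord F (v ++ w) = ofWord F v * ofWord F w := by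
  simp [ofWord, ← FreeGroup.mul_mk]

theorem ofWord_inv {k : ℕ} (F : SimpleGraph (Fin k)) (a : Symb k) :
    ofWord F [a.inv] = (ofWord F [a])⁻¹ := by
  simp [ofWord, ← map_inv, FreeGroup.inv_mk, FreeGroup.invRev, Symb.inv]

theorem ofSymb_commute {k : ℕ} (F : SimpleGraph (Fin k)) (a b : Symb k)
    (h : IndepSymb F a b) : Commute (ofWord F [a]) (ofWord F [b]) := by
  have key : Commute (ofWord F [(a.1, true)]) (ofWord F [(b.1, true)]) := by
    have h1 : PresentedGroup.mk (relators F) (FreeGroup.of a.1 * FreeGroup.of b.1 *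
        (FreeGroup.of a.1)⁻¹ * (FreeGroup.of b.1)⁻¹) = 1 :=
      PresentedGroup.one_of_mem ⟨a.1, b.1, h.2, rfl⟩
    rw [map_mul, map_mul, map_mul, map_inv, map_inv, mul_inv_eq_one, mul_inv_eq_iff_eq_mul] at h1
    exact h1
  have hinv : ∀ i : Fin k, ofWord F [(i, false)] = (ofWord F [(i, true)])⁻¹ := fun i =>
    ofWord_inv F (i, true)
  obtain ⟨i, s⟩ := a
  obtain ⟨j, u⟩ := b
  cases s <;> cases u <;> try simp only [hinv]
  · exact key.inv_inv
  · exact key.inv_left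
  · exact key.inv_right
  · exact key

/-- Every element is represented by a reduced word. -/
theorem exists_isReducedFor {k : ℕ} {F : SimpleGraph (Fin k)} (g : Grp F) :
    ∃ w : Word k, IsReducedFor F w g := by
  have hne : ∃ n, ∃ w : Word k, ofWord F w = g ∧ w.length = n := by
    obtain ⟨f, hf⟩ := PresentedGroup.mk_surjective (relators F) g
    refine ⟨_, f.toWord, ?_, rfl⟩
    rw [ofWord, FreeGroup.mk_toWord, hf]
  classical
  obtain ⟨w, hw, hlen⟩ := Nat.find_spec hne
  refine ⟨w, ?_, hw⟩
  rintro ⟨x, y, z, a, rfl, hy⟩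
  have hcomm : ∀ y : Word k, (∀ b ∈ y, IndepSymb F a b) →
      Commute (ofWord F [a]) (ofWord F y) := by
    intro y
    induction y with
    | nil => intro _; exact Commute.one_right _
    | cons b y ih =>
      intro hb
      have := ofWord_append F [b] y
      rw [List.singleton_append] at this
      rw [this]
      exact (ofSymb_commute F a b (hb b (by simp))).mul_right (ih fun c hc => hb c (by simp [hc]))
  have hc := hcomm y hy
  have hw' : ofWord F (x ++ y ++ z) = g := by
    rw [← hw]
    simp only [ofWord_append, ofWord_inv]
    rw [mul_assoc (ofWord F x) (ofWord F [a]) (ofWord F y), hc.eq]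
    simp [mul_assoc]
  have := Nat.find_min' hne ⟨_, hw', rfl⟩
  rw [← hlen] at this
  simp at this

/-- `|g|`: the size of any reduced word representing `g` (all of them have the same size, so the
infimum below is over a one-element set). -/
noncomputable def len {k : ℕ} {F : SimpleGraph (Fin k)} (g : Grp F) : ℕ :=
  sInf {n | ∃ w : Word k, IsReducedFor F w g ∧ w.length = n}

/-- The symbol `a` occurs in `g`: it occurs in any reduced word representing `g`. -/
def Contains {k : ℕ} {F : SimpleGraph (Fin k)} (g : Grp F) (a : Symb k) : Prop :=
  ∀ w : Word k, IsReducedFor F w g → a ∈ w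

/-- `z = x · y`: the product without cancellation, that is `z = x y` and `|z| = |x| + |y|`. -/
def IsDot {k : ℕ} {F : SimpleGraph (Fin k)} (z x y : Grp F) : Prop :=
  z = x * y ∧ len z = len x + len y

/-- The partial order `x ≤ y` : `y = x · a` for some `a`. -/
def Le {k : ℕ} {F : SimpleGraph (Fin k)} (x y : Grp F) : Prop :=
  ∃ a : Grp F, IsDot y x a

/-- `a` is a maximal symbol of `x`: `a⁻¹ ≤ x⁻¹`. -/
def IsMaximalSymb {k : ℕ} {F : SimpleGraph (Fin k)} (x : Grp F) (a : Symb k) : Prop :=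
  Le (ofSymb F a)⁻¹ x⁻¹

/-- An `a`-peak: an element whose only maximal symbol is `a`. -/
def IsPeak {k : ℕ} {F : SimpleGraph (Fin k)} (a : Symb k) (p : Grp F) : Prop :=
  IsMaximalSymb p a ∧ ∀ b : Symb k, IsMaximalSymb p b → b = a

/-- `g` is connected: the generators occurring in `g` (as `g_i` or as `g_i⁻¹`) induce a connected
subgraph of `F`. The empty subgraph (`g = 1`) counts as connected. -/
def IsConnected {k : ℕ} {F : SimpleGraph (Fin k)} (g : Grp F) : Prop :=
  (F.induce {i : Fin k | ∃ s : Bool, Contains g (i, s)}).Preconnected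

end GraphGroup

/-! Record a group element by the projections of a reduced word to the symbols over each pair of
equal or adjacent generators. Letting the group act on such families shows that they depend only on
the element (`IsReducedWord.tr_ofWord`). Products without cancellation become concatenations
(`IsDot.tr_eq`), and right factors are detected by suffixes (`exists_isDot_of_suffix`), so the
problem becomes one about lists.

Let `s` be what cancels in `(p * q) * p⁻¹`, with p = p₁·s. Then |pqp⁻¹| = 2|p₁| + |q|, so if |p|
exceeds the bound, |s| > 2|q|². Each projection of `s` is a suffix of itself followed by that of
`q`, hence periodic from the right. As `s` has no maximal symbol except α, it uses only generators
of `q` (`cnt_pos_of_suffix`). By pigeonhole, some generator is more than 2|q| times as frequent in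
`s` as in `q`. Adjacent generators share a projection, so this abundance spreads along paths in the
connected support of `q`, losing one period per edge (`walk_bound`). Hence every projection of `s`
ends in two copies of `q` (`two_copies_suffix`). One copy is split off, p = r·q; the other ends `r`
and makes it an α-peak again. Since rqr⁻¹ = pqp⁻¹, the bound is unchanged, and induction on |p|
concludes. -/

namespace GraphGroup

/-! ### Projections of words to dependent pairs -/

/-- Pairs of generators that are equal or joined by an edge of `F`. -/
abbrev DepPair {k : ℕ} (F : SimpleGraph (Fin k)) : Type :=
  {c : Fin k × Fin k // c.1 = c.2 ∨ F.Adj c.1 c.2}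

/-- The generator `i` is a member of the pair `c`. -/
abbrev Touches {k : ℕ} {F : SimpleGraph (Fin k)} (i : Fin k) (c : DepPair F) : Prop :=
  i = c.1.1 ∨ i = c.1.2

/-- The diagonal pair of a generator. -/
def diag {k : ℕ} (F : SimpleGraph (Fin k)) (i : Fin k) : DepPair F := ⟨(i, i), Or.inl rfl⟩

/-- The projection of a word to the symbols over a pair of dependent generators. -/
def proj {k : ℕ} (F : SimpleGraph (Fin k)) (w : Word k) (c : DepPair F) : Word k :=
  w.filter fun a => Touches a.1 c

variable {k : ℕ} {F : SimpleGraph (Fin k)}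

theorem touches_diag {i j : Fin k} : Touches i (diag F j) ↔ i = j := by simp [diag, Touches]

theorem IndepSymb.not_touches {a b : Symb k} (h : IndepSymb F a b) {c : DepPair F}
    (ha : Touches a.1 c) : ¬ Touches b.1 c := by
  obtain ⟨⟨i, j⟩, hc⟩ := c
  obtain ⟨h1, h2⟩ := h
  intro hb
  simp only [Touches] at ha hb hc
  rcases ha with ha | ha <;> rcases hb with hb | hb <;> rcases hc with hc | hc
  all_goals first
    | exact h1 (ha.trans hb.symm)
    | exact h1 (ha.trans (hc.trans hb.symm))
    | exact h1 (ha.trans (hc.symm.trans hb.symm))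
    | exact h2 (by rw [ha, hb]; exact hc)
    | exact h2 (by rw [ha, hb]; exact hc.symm)

theorem exists_touches_of_not_indep {a b : Symb k} (h : ¬ IndepSymb F a b) :
    ∃ c : DepPair F, Touches a.1 c ∧ Touches b.1 c := by
  refine ⟨⟨(a.1, b.1), ?_⟩, Or.inl rfl, Or.inr rfl⟩
  simp only [IndepSymb] at h
  tauto

@[simp] theorem Symb.inv_inv (a : Symb k) : a.inv.inv = a := by simp [Symb.inv]

@[simp] theorem Symb.inv_fst (a : Symb k) : a.inv.1 = a.1 := rfl

theorem IndepSymb.symm {a b : Symb k} (h : IndepSymb F a b) : IndepSymb F b a :=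
  ⟨h.1.symm, fun h' => h.2 h'.symm⟩

@[simp] theorem proj_nil (c : DepPair F) : proj F [] c = [] := rfl

@[simp] theorem proj_append (v w : Word k) (c : DepPair F) :
    proj F (v ++ w) c = proj F v c ++ proj F w c := by simp [proj]

theorem proj_cons (a : Symb k) (w : Word k) (c : DepPair F) :
    proj F (a :: w) c = if Touches a.1 c then a :: proj F w c else proj F w c := by
  simp [proj, List.filter_cons]

theorem proj_reverse (w : Word k) (c : DepPair F) :
    proj F w.reverse c = (proj F w c).reverse := by simp [proj]

theorem proj_eq_nil_of_indep {a : Symb k} {x : Word k} (hx : ∀ b ∈ x, IndepSymb F a b)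
    {c : DepPair F} (hc : Touches a.1 c) : proj F x c = [] := by
  rw [proj, List.filter_eq_nil_iff]
  intro b hb
  simpa using (hx b hb).not_touches hc

theorem proj_of_indep_prefix {a : Symb k} {x z : Word k} (hx : ∀ b ∈ x, IndepSymb F a b) :
    proj F (x ++ a :: z) = proj F (a :: (x ++ z)) := by
  funext c
  by_cases hc : Touches a.1 c
  · simp [proj_cons, hc, proj_eq_nil_of_indep hx hc]
  · simp [proj_cons, hc]

/-- The first letter of `w` dependent on `a` heads the projection to a pair touching both, so it is
`a` itself. -/
theorem exists_of_head {a : Symb k} {w : Word k}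
    (h : ∀ c : DepPair F, Touches a.1 c → (proj F w c).head? = some a) :
    ∃ x z : Word k, w = x ++ a :: z ∧ ∀ b ∈ x, IndepSymb F a b := by
  induction w with
  | nil => simpa using h (diag F a.1) (touches_diag.2 rfl)
  | cons b w ih =>
    by_cases hab : IndepSymb F a b
    · obtain ⟨x, z, rfl, hx⟩ := ih fun c hc => by
        simpa [proj_cons, hab.not_touches hc] using h c hc
      exact ⟨b :: x, z, rfl, List.forall_mem_cons.2 ⟨hab, hx⟩⟩
    · obtain ⟨c, hc, hc'⟩ := exists_touches_of_not_indep hab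
      have := h c hc
      rw [proj_cons, if_pos hc'] at this
      obtain rfl : b = a := by simpa using this
      exact ⟨[], w, rfl, by simp⟩

theorem exists_of_getLast {a : Symb k} {w : Word k}
    (h : ∀ c : DepPair F, Touches a.1 c → (proj F w c).getLast? = some a) :
    ∃ x z : Word k, w = x ++ a :: z ∧ ∀ b ∈ z, IndepSymb F a b := by
  obtain ⟨x, z, hw, hx⟩ := exists_of_head (F := F) (w := w.reverse) fun c hc => by
    rw [proj_reverse, List.head?_reverse, h c hc]
  refine ⟨z.reverse, x.reverse, ?_, by simpa using hx⟩
  rw [← w.reverse_reverse, hw]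
  simp

theorem commute_of_indep {a : Symb k} {y : Word k} (hy : ∀ b ∈ y, IndepSymb F a b) :
    Commute (ofWord F [a]) (ofWord F y) := by
  induction y with
  | nil => exact Commute.one_right _
  | cons b y ih =>
    have := ofWord_append F [b] y
    rw [List.singleton_append] at this
    rw [this]
    exact (ofSymb_commute F a b (hy b (by simp))).mul_right (ih fun c hc => hy c (by simp [hc]))

theorem ofWord_cons (a : Symb k) (w : Word k) : ofWord F (a :: w) = ofWord F [a] * ofWord F w := by
  rw [← ofWord_append, List.singleton_append]

theorem ofWord_of_indep_prefix {a : Symb k} {x z : Word k} (hx : ∀ b ∈ x, IndepSymb F a b) :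
    ofWord F (x ++ a :: z) = ofWord F (a :: (x ++ z)) := by
  rw [ofWord_append, ofWord_cons a z, ofWord_cons a (x ++ z), ofWord_append, ← mul_assoc,
    ← mul_assoc, (commute_of_indep hx).eq]

/-- The first letter of `v` heads all its projections in `w`, so it commutes to the front of `w` and
can be stripped from both words. -/
theorem ofWord_eq_of_proj_eq {v w : Word k} (h : proj F v = proj F w) :
    ofWord F v = ofWord F w := by
  induction v generalizing w with
  | nil =>
    cases w with
    | nil => rfl
    | cons b w =>
      have := congrFun h (diag F b.1)
      simp [proj_cons, touches_diag] at this
  | cons a v ih =>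
    obtain ⟨x, z, rfl, hx⟩ := exists_of_head (F := F) (a := a) (w := w) fun c hc => by
      rw [← h, proj_cons, if_pos hc, List.head?_cons]
    rw [proj_of_indep_prefix hx] at h
    rw [ofWord_of_indep_prefix hx, ofWord_cons, ofWord_cons a (x ++ z), ih]
    funext c
    have := congrFun h c
    by_cases hc : Touches a.1 c <;> simpa [proj_cons, hc] using this

theorem length_eq_sum_proj (w : Word k) :
    w.length = ∑ i : Fin k, (proj F w (diag F i)).length := by
  induction w with
  | nil => simp
  | cons a w ih =>
    have : ∀ i, (proj F (a :: w) (diag F i)).length =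
        (proj F w (diag F i)).length + if a.1 = i then 1 else 0 := by
      intro i
      rw [proj_cons]
      simp only [touches_diag]
      split_ifs <;> simp
    simp [this, Finset.sum_add_distrib, ← ih]

/-! ### Reduced words and the group action on their projections -/

theorem IsReducedWord.of_append_right {v w : Word k} (h : IsReducedWord F (v ++ w)) :
    IsReducedWord F w := by
  rintro ⟨x, y, z, a, rfl, hy⟩
  exact h ⟨v ++ x, y, z, a, by simp, hy⟩

theorem isReducedWord_nil : IsReducedWord F [] := by
  rintro ⟨x, y, z, a, h, -⟩
  simp at h

/-- Deleting a symbol independent of everything before it keeps a word reduced. -/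
theorem IsReducedWord.erase {a : Symb k} {x z : Word k} (h : IsReducedWord F (x ++ a :: z))
    (hx : ∀ b ∈ x, IndepSymb F a b) : IsReducedWord F (x ++ z) := by
  rintro ⟨x₁, y, z₁, b, hw, hy⟩
  have hw' : x ++ z = x₁ ++ (b :: (y ++ b.inv :: z₁)) := by simpa using hw
  rcases List.append_eq_append_iff.1 hw' with ⟨u, rfl, rfl⟩ | ⟨u, rfl, hu⟩
  · exact h ⟨x ++ a :: u, y, z₁, b, by simp, hy⟩
  · cases u with
    | nil => exact h ⟨x₁ ++ [a], y, z₁, b, by simp at hu ⊢; exact hu.symm, hy⟩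
    | cons b' u =>
      obtain ⟨rfl, hu'⟩ : b = b' ∧ y ++ b.inv :: z₁ = u ++ z := by simpa using hu
      have hab : IndepSymb F a b := hx b (by simp)
      rcases List.append_eq_append_iff.1 hu' with ⟨v, rfl, hv⟩ | ⟨v, rfl, rfl⟩
      · cases v with
        | nil =>
          refine h ⟨x₁, y ++ [a], z₁, b, by simp at hv ⊢; exact hv.symm, ?_⟩
          simp only [List.mem_append, List.mem_singleton]
          rintro c (hc | rfl)
          · exact hy c hc
          · exact hab.symm
        | cons c v =>
          obtain ⟨rfl, rfl⟩ : b.inv = c ∧ z₁ = v ++ z := by simpa using hv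
          exact h ⟨x₁, y, v ++ a :: z, b, by simp, hy⟩
      · refine h ⟨x₁, u ++ a :: v, z₁, b, by simp, ?_⟩
        simp only [List.mem_append, List.mem_cons] at hy ⊢
        rintro c (hc | rfl | hc)
        · exact hy c (Or.inl hc)
        · exact hab.symm
        · exact hy c (Or.inr hc)

open Classical in
/-- Left multiplication by a symbol on families of projections: cancel the inverse symbol if it
stands first in all relevant projections, prepend the symbol otherwise. -/
noncomputable def act (a : Symb k) (f : DepPair F → Word k) (c : DepPair F) : Word k :=
  if Touches a.1 c then
    if ∀ d : DepPair F, Touches a.1 d → (f d).head? = some a.inv then (f c).tail else a :: f c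
  else f c

theorem act_of_not_touches {a : Symb k} {f : DepPair F → Word k} {c : DepPair F}
    (hc : ¬ Touches a.1 c) : act a f c = f c := if_neg hc

/-- Locality of the action: since no pair touches two independent symbols, this makes their actions
commute. -/
theorem act_congr {a : Symb k} {f g : DepPair F → Word k}
    (h : ∀ c : DepPair F, Touches a.1 c → f c = g c) {c : DepPair F} (hc : Touches a.1 c) :
    act a f c = act a g c := by
  have : (∀ d : DepPair F, Touches a.1 d → (f d).head? = some a.inv) ↔
      ∀ d : DepPair F, Touches a.1 d → (g d).head? = some a.inv :=
    forall₂_congr fun d hd => by rw [h d hd]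
  unfold act
  rw [if_pos hc, if_pos hc, h c hc]
  by_cases hd : ∀ d : DepPair F, Touches a.1 d → (f d).head? = some a.inv
  · rw [if_pos hd, if_pos (this.1 hd)]
  · rw [if_neg hd, if_neg (mt this.2 hd)]

theorem act_comm {a b : Symb k} (hab : IndepSymb F a b) (f : DepPair F → Word k) :
    act a (act b f) = act b (act a f) := by
  funext c
  by_cases ha : Touches a.1 c
  · rw [act_of_not_touches (hab.not_touches ha)]
    exact act_congr (fun d hd => act_of_not_touches (hab.not_touches hd)) ha
  · rw [act_of_not_touches ha]
    by_cases hb : Touches b.1 c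
    · exact (act_congr (fun d hd => act_of_not_touches (hab.symm.not_touches hd)) hb).symm
    · rw [act_of_not_touches hb, act_of_not_touches hb, act_of_not_touches ha]

theorem act_proj_cancel {a : Symb k} (w : Word k) :
    act a (proj F (a.inv :: w)) = proj F w := by
  funext c
  by_cases hc : Touches a.1 c
  · rw [act, if_pos hc, if_pos]
    · rw [proj_cons, if_pos (by simpa using hc), List.tail_cons]
    · intro d hd
      rw [proj_cons, if_pos (by simpa using hd), List.head?_cons]
  · rw [act_of_not_touches hc, proj_cons, if_neg (by simpa using hc)]

theorem act_proj_of_reduced {a : Symb k} {w : Word k} (h : IsReducedWord F (a :: w)) :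
    act a (proj F w) = proj F (a :: w) := by
  funext c
  rw [proj_cons]
  by_cases hc : Touches a.1 c
  · rw [act, if_pos hc, if_neg, if_pos hc]
    intro hd
    obtain ⟨x, z, rfl, hx⟩ := exists_of_head (F := F) (a := a.inv) (w := w) hd
    exact h ⟨[], x, z, a, by simp, hx⟩
  · rw [act_of_not_touches hc, if_neg hc]

/-- Either `a :: w` is reduced, or `w` has an `a⁻¹` movable to the front, which cancels. Both cases
stay among reduced words and are undone by `a⁻¹`, so symbols act by permutations. -/
theorem act_proj_spec (a : Symb k) {w : Word k} (h : IsReducedWord F w) :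
    ∃ v : Word k, IsReducedWord F v ∧ act a (proj F w) = proj F v ∧
      act a.inv (proj F v) = proj F w := by
  by_cases hr : IsReducedWord F (a :: w)
  · refine ⟨a :: w, hr, act_proj_of_reduced hr, ?_⟩
    conv_lhs => rw [← a.inv_inv]
    simpa using act_proj_cancel (F := F) (a := a.inv) w
  · obtain ⟨x, y, z, b, hw, hy⟩ := not_not.1 hr
    cases x with
    | cons c x =>
      refine absurd ⟨x, y, z, b, ?_, hy⟩ h
      simp at hw ⊢
      exact hw.2
    | nil =>
      obtain ⟨rfl, rfl⟩ : a = b ∧ w = y ++ a.inv :: z := by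
        simp at hw
        obtain ⟨rfl, hw⟩ := hw
        exact ⟨rfl, hw⟩
      have hy' : ∀ b ∈ y, IndepSymb F a.inv b := hy
      refine ⟨y ++ z, h.erase hy', ?_, ?_⟩
      · rw [proj_of_indep_prefix hy', act_proj_cancel]
      · rw [proj_of_indep_prefix hy', act_proj_of_reduced]
        rintro ⟨x', y', z', b, hw', hb⟩
        cases x' with
        | cons c x' =>
          refine absurd ⟨x', y', z', b, ?_, hb⟩ (h.erase hy')
          simp at hw' ⊢
          exact hw'.2
        | nil =>
          obtain ⟨rfl, hw₂⟩ : a.inv = b ∧ y ++ z = y' ++ a :: z' := by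
            simp at hw'
            obtain ⟨rfl, hw'⟩ := hw'
            exact ⟨rfl, by simpa using hw'⟩
          rcases List.append_eq_append_iff.1 hw₂ with ⟨u, rfl, rfl⟩ | ⟨u, rfl, hu⟩
          · refine h ⟨y, u, z', a.inv, by simp, fun c hc => hb c (by simp [hc])⟩
          · cases u with
            | nil =>
              refine h ⟨y', [], z', a.inv, by simp at hu ⊢; exact hu.symm, by simp⟩
            | cons c u =>
              obtain ⟨rfl, -⟩ : a = c ∧ z' = u ++ z := by simpa using hu
              exact (hy a (by simp)).1 rfl

/-- Families of projections of reduced words. -/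
abbrev ReducedTrace {k : ℕ} (F : SimpleGraph (Fin k)) : Type :=
  {f : DepPair F → Word k // ∃ w, IsReducedWord F w ∧ proj F w = f}

theorem act_mem (a : Symb k) (f : ReducedTrace F) :
    ∃ w, IsReducedWord F w ∧ proj F w = act a f.1 := by
  obtain ⟨_, w, hw, rfl⟩ := f
  obtain ⟨v, hv, h, -⟩ := act_proj_spec a hw
  exact ⟨v, hv, h.symm⟩

theorem act_inv_act (a : Symb k) (f : ReducedTrace F) : act a.inv (act a f.1) = f.1 := by
  obtain ⟨_, w, hw, rfl⟩ := f
  obtain ⟨v, -, h, h'⟩ := act_proj_spec a hw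
  change act a.inv (act a (proj F w)) = proj F w
  rw [h, h']

/-- A symbol acts on reduced traces by a permutation. -/
noncomputable def actPerm (a : Symb k) : Equiv.Perm (ReducedTrace F) where
  toFun f := ⟨act a f.1, act_mem a f⟩
  invFun f := ⟨act a.inv f.1, act_mem a.inv f⟩
  left_inv f := Subtype.ext (act_inv_act a f)
  right_inv f := Subtype.ext (by simpa using act_inv_act a.inv f)

theorem actPerm_inv (a : Symb k) : (actPerm a.inv : Equiv.Perm (ReducedTrace F)) = (actPerm a)⁻¹ :=
  Equiv.ext fun _ => rfl

/-- The action of the graph group on reduced traces. -/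
noncomputable def actHom {k : ℕ} (F : SimpleGraph (Fin k)) :
    Grp F →* Equiv.Perm (ReducedTrace F) :=
  PresentedGroup.toGroup (f := fun i => actPerm (i, true)) <| by
    rintro _ ⟨i, j, hij, rfl⟩
    simp only [map_mul, map_inv, FreeGroup.lift_apply_of]
    rw [mul_inv_eq_one, mul_inv_eq_iff_eq_mul]
    by_cases h : i = j
    · rw [h]
    · exact Equiv.ext fun f => Subtype.ext (act_comm (a := (i, true)) (b := (j, true)) ⟨h, hij⟩ f.1)

theorem actHom_singleton (a : Symb k) : actHom F (ofWord F [a]) = actPerm a := by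
  have h : ∀ i : Fin k, actHom F (ofWord F [(i, true)]) = actPerm (i, true) := fun i =>
    PresentedGroup.toGroup.of _
  obtain ⟨i, b⟩ := a
  cases b
  · have h₁ := ofWord_inv F (i, true)
    have h₂ := actPerm_inv (F := F) (i, true)
    simp only [Symb.inv, Bool.not_true] at h₁ h₂
    rw [h₁, h₂, map_inv, h]
  · exact h i

/-! ### Traces and lengths of group elements -/

/-- The family of projections attached to a group element. -/
noncomputable def tr (g : Grp F) : DepPair F → Word k :=
  (actHom F g ⟨proj F [], [], isReducedWord_nil, rfl⟩).1

/-- Along a reduced word, acting on the empty trace never cancels. Hence all reduced words of an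
element share their projections, and so their length. -/
theorem IsReducedWord.tr_ofWord {w : Word k} (h : IsReducedWord F w) :
    tr (ofWord F w) = proj F w := by
  induction w with
  | nil =>
    have : ofWord F [] = 1 := rfl
    rw [tr, this, map_one]
    rfl
  | cons a w ih =>
    have hw : IsReducedWord F w := IsReducedWord.of_append_right (v := [a]) h
    have : tr (ofWord F (a :: w)) = act a (tr (ofWord F w)) := by
      rw [tr, ofWord_cons, map_mul, actHom_singleton]
      rfl
    rw [this, ih hw, act_proj_of_reduced h]

theorem IsReducedWord.length_eq {w : Word k} (h : IsReducedWord F w) :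
    w.length = ∑ i : Fin k, (tr (ofWord F w) (diag F i)).length := by
  rw [h.tr_ofWord, length_eq_sum_proj]

theorem IsReducedWord.len_ofWord {w : Word k} (h : IsReducedWord F w) :
    len (ofWord F w) = w.length := by
  have : {n | ∃ v : Word k, IsReducedFor F v (ofWord F w) ∧ v.length = n} = {w.length} := by
    ext n
    constructor
    · rintro ⟨v, ⟨hv, hvw⟩, rfl⟩
      rw [Set.mem_singleton_iff, hv.length_eq, h.length_eq, hvw]
    · rintro rfl
      exact ⟨w, ⟨h, rfl⟩, rfl⟩
  rw [len, this, csInf_singleton]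

theorem exists_reduced (g : Grp F) :
    ∃ w : Word k, IsReducedWord F w ∧ ofWord F w = g ∧ w.length = len g ∧ proj F w = tr g := by
  obtain ⟨w, hw, rfl⟩ := exists_isReducedFor g
  exact ⟨w, hw, rfl, hw.len_ofWord.symm, hw.tr_ofWord.symm⟩

theorem len_eq_sum (g : Grp F) : len g = ∑ i : Fin k, (tr g (diag F i)).length := by
  obtain ⟨w, hw, rfl, hl, -⟩ := exists_reduced g
  rw [← hl, hw.length_eq]

/-- A word that is not reduced can be shortened. -/
theorem len_lt_of_not_reduced {w : Word k} (h : ¬ IsReducedWord F w) :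
    ∃ v : Word k, ofWord F v = ofWord F w ∧ v.length < w.length := by
  obtain ⟨x, y, z, a, rfl, hy⟩ := not_not.1 h
  refine ⟨x ++ y ++ z, ?_, by simp⟩
  simp only [ofWord_append, ofWord_inv]
  rw [mul_assoc (ofWord F x) (ofWord F [a]) (ofWord F y), (commute_of_indep hy).eq]
  simp [mul_assoc]

theorem len_ofWord_le (w : Word k) : len (ofWord F w) ≤ w.length := by
  induction hn : w.length using Nat.strong_induction_on generalizing w with
  | _ n ih =>
    subst hn
    by_cases h : IsReducedWord F w
    · exact h.len_ofWord.le
    · obtain ⟨v, hv, hlt⟩ := len_lt_of_not_reduced h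
      rw [← hv]
      exact (ih _ hlt v rfl).trans hlt.le

theorem isReducedWord_of_length_le {w : Word k} (h : w.length ≤ len (ofWord F w)) :
    IsReducedWord F w := by
  by_contra hw
  obtain ⟨v, hv, hlt⟩ := len_lt_of_not_reduced hw
  have := len_ofWord_le (F := F) v
  rw [hv] at this
  omega

theorem len_mul_le (x y : Grp F) : len (x * y) ≤ len x + len y := by
  obtain ⟨v, -, rfl, hv, -⟩ := exists_reduced x
  obtain ⟨w, -, rfl, hw, -⟩ := exists_reduced y
  rw [← hv, ← hw, ← ofWord_append, ← List.length_append]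
  exact len_ofWord_le _

theorem ofWord_invRev (w : Word k) : ofWord F (FreeGroup.invRev w) = (ofWord F w)⁻¹ := by
  rw [ofWord, ofWord, ← map_inv, FreeGroup.inv_mk]

theorem len_inv (x : Grp F) : len x⁻¹ = len x := by
  have h : ∀ y : Grp F, len y⁻¹ ≤ len y := by
    intro y
    obtain ⟨w, -, rfl, hw, -⟩ := exists_reduced y
    rw [← hw, ← ofWord_invRev, ← FreeGroup.invRev_length (L₁ := w)]
    exact len_ofWord_le _
  exact le_antisymm (h x) (by simpa using h x⁻¹)

theorem len_ofSymb (a : Symb k) : len (ofSymb F a) = 1 := by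
  refine IsReducedWord.len_ofWord (w := [a]) ?_
  rintro ⟨x, y, z, b, h, -⟩
  have := congrArg List.length h
  simp at this
  omega

theorem tr_ofSymb (a : Symb k) (c : DepPair F) :
    tr (ofSymb F a) c = if Touches a.1 c then [a] else [] := by
  have h : IsReducedWord F [a] := isReducedWord_of_length_le (len_ofSymb a).ge
  rw [ofSymb, h.tr_ofWord, proj_cons, proj_nil]

/-! ### Products without cancellation, right factors and maximal symbols -/

/-- A product without cancellation concatenates the projections. -/
theorem IsDot.tr_eq {x y z : Grp F} (h : IsDot z x y) (c : DepPair F) :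
    tr z c = tr x c ++ tr y c := by
  obtain ⟨v, -, rfl, hv, hv'⟩ := exists_reduced x
  obtain ⟨w, -, rfl, hw, hw'⟩ := exists_reduced y
  obtain ⟨rfl, hl⟩ := h
  rw [← ofWord_append, ← hv, ← hw, ← List.length_append] at hl
  rw [← ofWord_append, (isReducedWord_of_length_le hl.ge).tr_ofWord, proj_append, hv', hw']

theorem exists_suffix_of_proj {t w : Word k}
    (h : ∀ c : DepPair F, proj F t c <:+ proj F w c) :
    ∃ u : Word k, proj F w = proj F (u ++ t) := by
  induction t using List.reverseRecOn generalizing w with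
  | nil => exact ⟨w, by simp⟩
  | append_singleton t a ih =>
    obtain ⟨x, z, rfl, hz⟩ := exists_of_getLast (F := F) (a := a) (w := w) fun c hc => by
      obtain ⟨v, hv⟩ := h c
      rw [← hv]
      simp [proj_cons, hc]
    have hw : proj F (x ++ a :: z) = proj F (x ++ z ++ [a]) := by
      funext c
      by_cases hc : Touches a.1 c
      · simp [proj_cons, hc, proj_eq_nil_of_indep hz hc]
      · simp [proj_cons, hc]
    rw [hw] at h ⊢
    obtain ⟨u, hu⟩ := ih (w := x ++ z) fun c => by
      obtain ⟨v, hv⟩ := h c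
      refine ⟨v, ?_⟩
      rw [proj_append, proj_append (x ++ z), ← List.append_assoc] at hv
      exact List.append_cancel_right hv
    refine ⟨u, ?_⟩
    funext c
    rw [proj_append, hu, ← List.append_assoc, proj_append (u ++ t)]

/-- An element whose projections are suffixes of those of `w` is a right factor of `w`. -/
theorem exists_isDot_of_suffix {t w : Grp F} (h : ∀ c : DepPair F, tr t c <:+ tr w c) :
    ∃ u : Grp F, IsDot w u t := by
  obtain ⟨t, -, rfl, ht, ht'⟩ := exists_reduced t
  obtain ⟨w, hw, rfl, hwl, hw'⟩ := exists_reduced w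
  rw [← ht', ← hw'] at h
  obtain ⟨u, hu⟩ := exists_suffix_of_proj h
  have he : ofWord F w = ofWord F u * ofWord F t := by
    rw [ofWord_eq_of_proj_eq hu, ofWord_append]
  refine ⟨ofWord F u, he, le_antisymm (he ▸ len_mul_le _ _) ?_⟩
  have hl : w.length = (u ++ t).length := by
    rw [length_eq_sum_proj (F := F), hu, ← length_eq_sum_proj]
  rw [← hwl, hl, List.length_append, ← ht]
  exact Nat.add_le_add_right (len_ofWord_le u) _

theorem isMaximalSymb_iff_exists {x : Grp F} {a : Symb k} :
    IsMaximalSymb x a ↔ ∃ u : Grp F, IsDot x u (ofSymb F a) := by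
  constructor
  · rintro ⟨b, hb, hl⟩
    refine ⟨b⁻¹, by simpa using congrArg (·⁻¹) hb, ?_⟩
    rw [len_inv, len_inv] at hl
    rw [len_inv, hl, add_comm]
  · rintro ⟨u, hu, hl⟩
    refine ⟨u⁻¹, by rw [hu, mul_inv_rev], ?_⟩
    rw [len_inv, len_inv, len_inv, hl, add_comm]

/-- A symbol is maximal iff it stands last in all relevant projections. -/
theorem isMaximalSymb_iff {x : Grp F} {a : Symb k} :
    IsMaximalSymb x a ↔ ∀ c : DepPair F, Touches a.1 c → (tr x c).getLast? = some a := by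
  rw [isMaximalSymb_iff_exists]
  constructor
  · rintro ⟨u, hu⟩ c hc
    rw [hu.tr_eq, tr_ofSymb, if_pos hc]
    simp
  · intro h
    refine exists_isDot_of_suffix fun c => ?_
    rw [tr_ofSymb]
    split_ifs with hc
    · rw [List.singleton_suffix_iff_getLast?_eq_some]
      exact h c hc
    · exact List.nil_suffix

/-- The common right part of `z` and `p` is exactly what cancels in `z * p⁻¹`. -/
theorem exists_common_right_factor (z p : Grp F) :
    ∃ z₁ p₁ s : Grp F, IsDot z z₁ s ∧ IsDot p p₁ s ∧ len (z * p⁻¹) = len z₁ + len p₁ := by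
  induction hn : len z using Nat.strong_induction_on generalizing z p with
  | _ n ih =>
    subst hn
    by_cases hl : len (z * p⁻¹) = len z + len p
    · have h1 : len (1 : Grp F) = 0 := by
        exact (isReducedWord_nil (F := F)).len_ofWord
      exact ⟨z, p, 1, ⟨by simp, by simp [h1]⟩, ⟨by simp, by simp [h1]⟩, hl⟩
    · have key : ∃ a : Symb k, IsMaximalSymb z a ∧ IsMaximalSymb p a := by
        obtain ⟨v, hv, hvz, hvl, hv'⟩ := exists_reduced z
        obtain ⟨w, hw, hwp, hwl, hw'⟩ := exists_reduced p⁻¹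
        have hnr : ¬ IsReducedWord F (v ++ w) := fun h => hl <| by
          rw [← hvz, ← hwp, ← ofWord_append, h.len_ofWord, List.length_append, hvl, hwl, hvz,
            len_inv]
        -- As `v` and `w` are reduced, the cancelling pair has `a` in `v` and `a⁻¹` in `w`; this `a`
        -- is maximal in both `z` and `p`.
        obtain ⟨x, y, z', a, hx, hy⟩ := not_not.1 hnr
        have hx' : v ++ w = x ++ (a :: (y ++ a.inv :: z')) := by simpa using hx
        rcases List.append_eq_append_iff.1 hx' with ⟨u, rfl, rfl⟩ | ⟨u, rfl, hu⟩
        · exact absurd ⟨u, y, z', a, by simp, hy⟩ hw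
        · cases u with
          | nil => exact absurd ⟨[], y, z', a, by simpa using hu.symm, hy⟩ hw
          | cons a' u =>
            obtain ⟨rfl, hu'⟩ : a = a' ∧ y ++ a.inv :: z' = u ++ w := by simpa using hu
            rcases List.append_eq_append_iff.1 hu' with ⟨u', rfl, hw₂⟩ | ⟨u', rfl, rfl⟩
            · cases u' with
              | nil =>
                refine ⟨a, isMaximalSymb_iff.2 fun c hc => ?_, ?_⟩
                · rw [← hv', proj_append, proj_cons, if_pos hc, List.append_nil,
                    proj_eq_nil_of_indep (x := y) hy hc]
                  simp
                · obtain rfl : w = a.inv :: z' := by simpa using hw₂.symm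
                  rw [ofWord_cons, ofWord_inv] at hwp
                  refine ⟨ofWord F z', hwp.symm, ?_⟩
                  rw [len_inv (ofSymb F a), len_ofSymb,
                    (IsReducedWord.of_append_right (v := [a.inv]) hw).len_ofWord, ← hwl]
                  simp
                  omega
              | cons b u' =>
                obtain ⟨rfl, rfl⟩ : a.inv = b ∧ z' = u' ++ w := by simpa using hw₂
                exact absurd ⟨x, y, u', a, by simp, hy⟩ hv
            · refine ⟨a, isMaximalSymb_iff.2 fun c hc => ?_, ?_⟩
              · rw [← hv', proj_append, proj_cons, if_pos hc,
                  proj_eq_nil_of_indep (x := u) (fun b hb => hy b (by simp [hb])) hc]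
                simp
              · have hind : ∀ b ∈ u', IndepSymb F a.inv b := fun b hb => hy b (by simp [hb])
                have he := ofWord_of_indep_prefix (F := F) (z := z') hind
                rw [hwp, ofWord_cons, ofWord_inv] at he
                refine ⟨ofWord F (u' ++ z'), he, ?_⟩
                rw [len_inv (ofSymb F a), len_ofSymb, (hw.erase hind).len_ofWord, ← hwl]
                simp
                omega
      obtain ⟨a, hz, hp⟩ := key
      obtain ⟨z', hz', hzl⟩ := isMaximalSymb_iff_exists.1 hz
      obtain ⟨p', hp', hpl⟩ := isMaximalSymb_iff_exists.1 hp
      rw [len_ofSymb] at hzl hpl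
      obtain ⟨z₁, p₁, s, ⟨hz₁, hzl₁⟩, ⟨hp₁, hpl₁⟩, h⟩ := ih (len z') (by omega) z' p' rfl
      have e₁ : z = z₁ * (s * ofSymb F a) := by rw [hz', hz₁, mul_assoc]
      have e₂ : p = p₁ * (s * ofSymb F a) := by rw [hp', hp₁, mul_assoc]
      -- Subadditivity forces |s·a| = |s| + 1, because `z` already attains the full length.
      have l₁ := len_mul_le z₁ (s * ofSymb F a)
      have l₂ := len_mul_le p₁ (s * ofSymb F a)
      have l₃ := len_mul_le s (ofSymb F a)
      rw [← e₁] at l₁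
      rw [← e₂] at l₂
      rw [len_ofSymb] at l₃
      refine ⟨z₁, p₁, s * ofSymb F a, ⟨e₁, by omega⟩, ⟨e₂, by omega⟩, ?_⟩
      rw [← h, hz', hp']
      congr 1
      group

/-! ### Periodicity of lists -/

/-- A list `S` that is a suffix of `S ++ Q` has at least `j` copies of `Q` as a suffix as soon as
some letters occur more than `j` times as often in `S` as in `Q`. -/
theorem flatten_replicate_suffix {β : Type*} {S Q : List β} (h : S <:+ S ++ Q) (P : β → Bool)
    {j : ℕ} (hj : j * Q.countP P < S.countP P) : (List.replicate j Q).flatten <:+ S := by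
  induction j generalizing S with
  | zero => simp
  | succ j ih =>
    -- `S` and `Q` both end `S ++ Q`, so one is a suffix of the other; `S` within `Q` would
    -- contradict the count.
    rcases List.suffix_or_suffix_of_suffix h (List.suffix_append S Q) with hS | ⟨S', rfl⟩
    · have := hS.sublist.countP_le (p := P)
      nlinarith
    · have hS' : S' <:+ S' ++ Q := by
        obtain ⟨u, hu⟩ := h
        exact ⟨u, List.append_cancel_right (by rw [← hu, List.append_assoc])⟩
      obtain ⟨u, hu⟩ := ih hS' (by rw [List.countP_append] at hj; nlinarith)
      refine ⟨u, ?_⟩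
      rw [List.replicate_succ', List.flatten_concat, ← List.append_assoc, hu]

theorem forall_mem_of_suffix_append {β : Type*} {S Q : List β} (h : S <:+ S ++ Q) (hQ : Q ≠ [])
    {P : β → Prop} (hP : ∀ b ∈ Q, P b) : ∀ b ∈ S, P b := by
  induction hn : S.length using Nat.strong_induction_on generalizing S with
  | _ n ih =>
    subst hn
    rcases List.suffix_or_suffix_of_suffix h (List.suffix_append S Q) with hS | ⟨S', rfl⟩
    · exact fun b hb => hP b (hS.subset hb)
    · have hS' : S' <:+ S' ++ Q := by
        obtain ⟨u, hu⟩ := h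
        exact ⟨u, List.append_cancel_right (by rw [← hu, List.append_assoc])⟩
      have := ih S'.length (by simpa using List.length_pos_iff.2 hQ) hS' rfl
      intro b hb
      rcases List.mem_append.1 hb with hb | hb
      · exact this b hb
      · exact hP b hb

/-! ### Counting generators in traces -/

/-- The number of occurrences of the generator `i`, in either sign. -/
noncomputable def cnt (g : Grp F) (i : Fin k) : ℕ := (tr g (diag F i)).length

theorem countP_proj (w : Word k) {i : Fin k} {c : DepPair F} (hc : Touches i c) :
    (proj F w c).countP (fun a => a.1 = i) = (proj F w (diag F i)).length := by
  rw [proj, proj, List.countP_filter, ← List.countP_eq_length_filter]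
  refine List.countP_congr fun a _ => ?_
  simp only [touches_diag, Bool.and_eq_true, decide_eq_true_eq]
  constructor
  · exact fun h => h.1
  · rintro rfl
    exact ⟨rfl, hc⟩

theorem countP_tr (g : Grp F) {i : Fin k} {c : DepPair F} (hc : Touches i c) :
    (tr g c).countP (fun a => a.1 = i) = cnt g i := by
  obtain ⟨w, -, -, -, hw⟩ := exists_reduced g
  rw [cnt, ← hw, countP_proj w hc]

theorem touches_of_mem_tr {g : Grp F} {c : DepPair F} {a : Symb k} (h : a ∈ tr g c) :
    Touches a.1 c := by
  obtain ⟨w, -, -, -, hw⟩ := exists_reduced g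
  rw [← hw, proj, List.mem_filter] at h
  simpa using h.2

theorem mem_tr_iff {g : Grp F} {c : DepPair F} {a : Symb k} (hc : Touches a.1 c) :
    a ∈ tr g c ↔ a ∈ tr g (diag F a.1) := by
  obtain ⟨w, -, -, -, hw⟩ := exists_reduced g
  rw [← hw, proj, proj, List.mem_filter, List.mem_filter]
  simp [touches_diag, hc]

theorem cnt_pos_of_mem {g : Grp F} {c : DepPair F} {a : Symb k} (h : a ∈ tr g c) :
    0 < cnt g a.1 :=
  List.length_pos_of_mem ((mem_tr_iff (touches_of_mem_tr h)).1 h)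

theorem exists_mem_of_cnt_pos {g : Grp F} {i : Fin k} (h : 0 < cnt g i) {c : DepPair F}
    (hc : Touches i c) : ∃ a ∈ tr g c, a.1 = i := by
  rw [← countP_tr g hc, List.countP_pos_iff] at h
  simpa using h

theorem contains_iff {g : Grp F} {a : Symb k} : Contains g a ↔ a ∈ tr g (diag F a.1) := by
  obtain ⟨w, hw, hg, -, hw'⟩ := exists_reduced g
  constructor
  · intro h
    rw [← hw', proj, List.mem_filter]
    exact ⟨h w ⟨hw, hg⟩, by simp [touches_diag]⟩
  · rintro h v ⟨hv, rfl⟩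
    rw [hv.tr_ofWord, proj, List.mem_filter] at h
    exact h.1

theorem exists_contains_iff {g : Grp F} {i : Fin k} :
    (∃ s : Bool, Contains g (i, s)) ↔ 0 < cnt g i := by
  constructor
  · rintro ⟨s, hs⟩
    exact cnt_pos_of_mem (contains_iff.1 hs)
  · intro h
    obtain ⟨⟨_, s⟩, ha, rfl⟩ := exists_mem_of_cnt_pos h (touches_diag.2 rfl)
    exact ⟨s, contains_iff.2 ha⟩

theorem len_eq_sum_cnt (g : Grp F) : len g = ∑ i : Fin k, cnt g i := len_eq_sum g

theorem IsMaximalSymb.of_isDot {x y z : Grp F} {a : Symb k} (h : IsDot z x y)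
    (ha : IsMaximalSymb y a) : IsMaximalSymb z a := by
  rw [isMaximalSymb_iff] at ha ⊢
  intro c hc
  rw [h.tr_eq, List.getLast?_append, ha c hc]
  rfl

/-! ### Spreading periodicity over the support of `q` -/

/-- If `s` is a suffix of `s q` as a trace and every maximal symbol of `s` occurs in `q`, then all
generators of `s` occur in `q`. -/
theorem cnt_pos_of_suffix {s q : Grp F} (h : ∀ c : DepPair F, tr s c <:+ tr s c ++ tr q c)
    (hmax : ∀ a : Symb k, IsMaximalSymb s a → 0 < cnt q a.1) {i : Fin k} (hi : 0 < cnt s i) :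
    0 < cnt q i := by
  by_contra hqi
  obtain ⟨w, -, -, -, hw⟩ := exists_reduced s
  have hex : ∃ a ∈ w, cnt q a.1 = 0 := by
    obtain ⟨a, ha, rfl⟩ := exists_mem_of_cnt_pos hi (touches_diag.2 rfl)
    rw [← hw, proj, List.mem_filter] at ha
    exact ⟨a, ha.1, by omega⟩
  -- Take the last letter `b` of `s` foreign to `q`. If it depended on a later letter, their shared
  -- projection would be periodic with a nonempty period from `q`, excluding `b`. So `b` is maximal.
  obtain ⟨x, b, z, rfl, hb, hz⟩ : ∃ x b z, w = x ++ b :: z ∧ cnt q b.1 = 0 ∧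
      ∀ a ∈ z, 0 < cnt q a.1 := by
    clear hw
    induction w with
    | nil => simp at hex
    | cons a w ih =>
      by_cases hw : ∃ a ∈ w, cnt q a.1 = 0
      · obtain ⟨x, b, z, rfl, hbz⟩ := ih hw
        exact ⟨a :: x, b, z, rfl, hbz⟩
      · obtain ⟨b, hb, hb0⟩ := hex
        rcases List.mem_cons.1 hb with rfl | hb
        · refine ⟨[], b, w, rfl, hb0, fun a ha => Nat.pos_of_ne_zero fun h0 => hw ⟨a, ha, h0⟩⟩
        · exact absurd ⟨b, hb, hb0⟩ hw
  have hind : ∀ a ∈ z, IndepSymb F b a := by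
    intro a ha
    by_contra hba
    obtain ⟨c, hc, hc'⟩ := exists_touches_of_not_indep hba
    obtain ⟨a', ha', -⟩ := exists_mem_of_cnt_pos (hz a ha) hc'
    have hbs : b ∈ tr s c := by
      rw [← hw, proj, List.mem_filter]
      simp [hc]
    have := forall_mem_of_suffix_append (h c) (List.ne_nil_of_mem ha')
      (P := fun a => 0 < cnt q a.1) (fun a ha => cnt_pos_of_mem ha) b hbs
    omega
  have := hmax b <| isMaximalSymb_iff.2 fun c hc => by
    rw [← hw, proj_append, proj_cons, if_pos hc, proj_eq_nil_of_indep hind hc]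
    simp
  omega

/-- Abundance of `i` forces `n` copies of `q` at the end of the shared projection, and these also
contain `j`. -/
theorem suffix_step {s q : Grp F} (h : ∀ c : DepPair F, tr s c <:+ tr s c ++ tr q c)
    {c : DepPair F} {i j : Fin k} (hi : Touches i c) (hj : Touches j c) {n : ℕ}
    (hn : n * cnt q i < cnt s i) : n * cnt q j ≤ cnt s j := by
  have := (flatten_replicate_suffix (h c) (fun a => a.1 = i) (j := n)
    (by rwa [countP_tr q hi, countP_tr s hi])).sublist.countP_le (p := fun a => a.1 = j)
  simpa [countP_tr _ hj, List.countP_flatten] using this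

theorem walk_bound {s q : Grp F} (h : ∀ c : DepPair F, tr s c <:+ tr s c ++ tr q c)
    {i j : {i : Fin k | ∃ s : Bool, Contains q (i, s)}}
    (w : (F.induce {i : Fin k | ∃ s : Bool, Contains q (i, s)}).Walk i j) {n : ℕ}
    (hn : (n + w.length) * cnt q i < cnt s i) : n * cnt q j < cnt s j := by
  induction w with
  | nil => simpa using hn
  | @cons u v w hadj p ih =>
    refine ih ?_
    have hadj' : F.Adj u v := hadj
    have hv : 0 < cnt q v := exists_contains_iff.1 v.2
    have := suffix_step h (c := ⟨(u.1, v.1), Or.inr hadj'⟩) (Or.inl rfl) (Or.inr rfl) hn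
    rw [SimpleGraph.Walk.length_cons] at this
    -- Giving up one copy of `q` turns `≤` back into `<`, as `v` occurs in `q`.
    nlinarith

/-- If `s` is a long suffix of `s q` with the generators of `q`, then `q q` is a suffix of `s`. -/
theorem two_copies_suffix {s q : Grp F} (hq : IsConnected q)
    (h : ∀ c : DepPair F, tr s c <:+ tr s c ++ tr q c)
    (hsupp : ∀ i : Fin k, 0 < cnt s i → 0 < cnt q i)
    (hlen : 2 * len q * len q < len s) (c : DepPair F) : tr q c ++ tr q c <:+ tr s c := by
  obtain ⟨i, -, hi⟩ : ∃ i ∈ Finset.univ, 2 * len q * cnt q i < cnt s i := by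
    refine Finset.exists_lt_of_sum_lt ?_
    rwa [← Finset.mul_sum, ← len_eq_sum_cnt, ← len_eq_sum_cnt]
  by_cases hc : tr q c = []
  · simp [hc]
  obtain ⟨a, ha⟩ := List.exists_mem_of_ne_nil _ hc
  have hqi := hsupp i (by omega)
  have hqa := cnt_pos_of_mem ha
  have htc := touches_of_mem_tr ha
  classical
  obtain ⟨w⟩ := hq ⟨i, exists_contains_iff.2 hqi⟩ ⟨a.1, exists_contains_iff.2 hqa⟩
  have hw := w.bypass_isPath.length_lt
  have hcard : Fintype.card {i : Fin k | ∃ s : Bool, Contains q (i, s)} ≤ len q := by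
    rw [len_eq_sum_cnt, ← Set.toFinset_card, Finset.card_eq_sum_ones]
    refine (Finset.sum_le_sum fun i hi => ?_).trans
      (Finset.sum_le_sum_of_subset (Finset.subset_univ _))
    rw [Set.mem_toFinset] at hi
    exact exists_contains_iff.1 hi
  -- The path has at most |q| - 1 edges, so 2 plus its length is at most |q| + 1 ≤ 2|q|.
  have hb := walk_bound h w.bypass (n := 2) <| lt_of_le_of_lt
    (Nat.mul_le_mul_right _ (by omega)) hi
  have := flatten_replicate_suffix (h c) (fun b => b.1 = a.1) (j := 2)
    (by rwa [countP_tr q htc, countP_tr s htc])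
  simpa [List.replicate_succ] using this

/-! ### Shortening peaks -/

/-- A sufficiently long peak can be shortened by one factor `q`. -/
theorem IsPeak.exists_isDot {α : Symb k} {p q : Grp F} (hq : IsConnected q) (hα : Contains q α)
    (hp : IsPeak α p) (hpq : Le p (p * q)) (hlen : 2 * len (p * q * p⁻¹) ^ 2 < len p) :
    ∃ r : Grp F, IsPeak α r ∧ IsDot p r q ∧ Le r (r * q) := by
  rw [contains_iff] at hα
  obtain ⟨a, ha⟩ := hpq
  obtain rfl : q = a := mul_left_cancel ha.1
  obtain ⟨z₁, p₁, s, hz, hps, hn⟩ := exists_common_right_factor (p * q) p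
  have h : ∀ c : DepPair F, tr s c <:+ tr s c ++ tr q c := by
    intro c
    -- Both lists are suffixes of the projection of `p * q`.
    refine List.suffix_of_suffix_length_le (l₃ := tr (p * q) c) ⟨_, (hz.tr_eq c).symm⟩ ?_ (by simp)
    rw [ha.tr_eq, hps.tr_eq]
    exact ⟨tr p₁ c, by simp⟩
  have hsupp : ∀ i : Fin k, 0 < cnt s i → 0 < cnt q i := fun i hi =>
    cnt_pos_of_suffix h (fun b hb => by
      rw [hp.2 b (hb.of_isDot hps)]
      exact cnt_pos_of_mem hα) hi
  have hs : 2 * len q * len q < len s := by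
    have h₁ := ha.2
    have h₂ := hz.2
    have h₃ := hps.2
    have h₄ : len (p * q * p⁻¹) = 2 * len p₁ + len q := by omega
    rw [h₄] at hlen
    -- 2(2|p₁| + |q|)² ≥ |p₁| + 2|q|², while |s| = |p| - |p₁|.
    nlinarith [Nat.le_self_pow two_ne_zero (len p₁), Nat.zero_le (len p₁ * len q)]
  have hqq : ∀ c : DepPair F, tr q c ++ tr q c <:+ tr p c := fun c =>
    (two_copies_suffix hq h hsupp hs c).trans ⟨_, (hps.tr_eq c).symm⟩
  obtain ⟨r, hr⟩ := exists_isDot_of_suffix fun c => (List.suffix_append _ _).trans (hqq c)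
  obtain ⟨w, hw⟩ : ∃ w : Grp F, IsDot r w q := exists_isDot_of_suffix fun c => by
    obtain ⟨u, hu⟩ := hqq c
    rw [hr.tr_eq, ← List.append_assoc] at hu
    exact ⟨u, List.append_cancel_right hu⟩
  -- Where the projection of `q` is nonempty, `p` and `r` both end in it; elsewhere their
  -- projections coincide. So they have the same maximal symbols.
  refine ⟨r, ⟨?_, fun b hb => ?_⟩, hr, q, by rw [← hr.1], ?_⟩
  · rw [isMaximalSymb_iff]
    intro c hc
    have hne : tr q c ≠ [] := List.ne_nil_of_mem ((mem_tr_iff hc).2 hα)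
    have := isMaximalSymb_iff.1 hp.1 c hc
    rw [hr.tr_eq, List.getLast?_append_of_ne_nil _ hne] at this
    rw [hw.tr_eq, List.getLast?_append_of_ne_nil _ hne, this]
  · refine hp.2 b (isMaximalSymb_iff.2 fun c hc => ?_)
    have hb := isMaximalSymb_iff.1 hb c hc
    rw [hr.tr_eq]
    by_cases hne : tr q c = []
    · rw [hne, List.append_nil, hb]
    · rw [hw.tr_eq, List.getLast?_append_of_ne_nil _ hne] at hb
      rw [List.getLast?_append_of_ne_nil _ hne, hb]
  · rw [← hr.1, hr.2]

end GraphGroup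

theorem mainTheorem8 (k : ℕ) (F : SimpleGraph (Fin k)) (α : GraphGroup.Symb k)
    (q : GraphGroup.Grp F) (hq : GraphGroup.IsConnected q) (hα : GraphGroup.Contains q α)
    (p : GraphGroup.Grp F) (hp : GraphGroup.IsPeak α p) (hpq : GraphGroup.Le p (p * q)) :
    ∃ (r : GraphGroup.Grp F) (t : ℕ), GraphGroup.IsPeak α r ∧
      GraphGroup.IsDot p r (q ^ t) ∧
      GraphGroup.len r ≤ 2 * GraphGroup.len (p * q * p⁻¹) ^ 2 := by
  induction hn : GraphGroup.len p using Nat.strong_induction_on generalizing p with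
  | _ n ih =>
    subst hn
    rcases le_or_gt (GraphGroup.len p) (2 * GraphGroup.len (p * q * p⁻¹) ^ 2) with hl | hl
    · have h1 : GraphGroup.len (1 : GraphGroup.Grp F) = 0 :=
        (GraphGroup.isReducedWord_nil (F := F)).len_ofWord
      exact ⟨p, 0, hp, ⟨by simp, by simp [h1]⟩, hl⟩
    · obtain ⟨r, hr, hpr, hrq⟩ := hp.exists_isDot hq hα hpq hl
      have hq0 : 0 < GraphGroup.len q := by
        rw [GraphGroup.len_eq_sum_cnt]
        exact Finset.sum_pos' (fun _ _ => Nat.zero_le _)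
          ⟨α.1, Finset.mem_univ _, GraphGroup.cnt_pos_of_mem (GraphGroup.contains_iff.1 hα)⟩
      have hlp := hpr.2
      obtain ⟨r', t, hr', hrt, hle⟩ := ih _ (by omega) r hr hrq rfl
      have he : p = r' * q ^ (t + 1) := by rw [hpr.1, hrt.1, pow_succ, mul_assoc]
      have h₁ := GraphGroup.len_mul_le r' (q ^ (t + 1))
      have h₂ := GraphGroup.len_mul_le (q ^ t) q
      rw [← pow_succ] at h₂
      rw [← he] at h₁
      have h₃ := hrt.2
      refine ⟨r', t + 1, hr', ⟨he, by omega⟩, ?_⟩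
      have hc : p * q * p⁻¹ = r * q * r⁻¹ := by rw [hpr.1]; group
      rwa [hc]
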